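/- **The target calculus $\lambda_\delta$.** A diffeological space is a set with a family of plots $\mathbb R^m\supseteq U\to X$ containing the constant maps and closed under smooth reparametrisation and gluing; $\mathbf{Diff}$ is the cartesian closed category of these spaces and the maps preserving plots. The types of $\lambda_\delta$ are $$\tau::=\mathbb R\mid\mathbb R^+\mid\mathsf{Pred}(\mathbb R^n)\mid\mathbb N\mid\tau\times\tau\mid\mathcal D(\mathbb R^n)\mid\mathcal D'(\mathbb R^n)\mid\tau\to\tau\qquad(n\ge 1),$$ and $[\![-]\!]$ interprets types as diffeological spaces and terms $\Gamma\vdash t:\tau$ as morphisms $[\![\Gamma]\!]\to[\![\tau]\!]$ of $\mathbf{Diff}$. Here products and arrows are products and internal homs; $\mathsf{Pred}(\mathbb R^n)$ (the measurable subsets) and $\mathbb N$ carry the diffeology of (locally) constant plots; $\mathcal D(\mathbb R^n)=C^\infty_c(\mathbb R^n)$, where $p:U\to\mathcal D(\mathbb R^n)$ is a plot iff $(s,x)\mapsto p(s)(x)$ is smooth and, locally in $s$, the supports of the $p(s)$ lie in a common compact set; and $\mathcal D'(\mathbb R^n)$ is the set of continuous linear functionals on $\mathcal D(\mathbb R^n)$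 (with its usual topology), as a subspace of the internal hom $\mathcal D(\mathbb R^n)\Rightarrow\mathbb R$. The terms are those of the simply typed $\lambda$-calculus with pairs, $\mathsf{let}\,(x,y)=t\,\mathsf{in}\,u$ and $\mathsf{let}\,x=t\,\mathsf{in}\,u$; real constants, $+$, $\cdot$, the sigmoid $\varsigma$ and application $f(t_1,\dots,t_n)$ of an arbitrary smooth $f:\mathbb R^n\to\mathbb R$; positive constants, sums and products in $\mathbb R^+$; zero, successor and iteration for $\mathbb N$; comparisons $\lambda x{:}\mathbb R^n.\,t<u$ and $\lambda x.\,t\le u$ and their Boolean combinations in $\mathsf{Pred}(\mathbb R^n)$; and the following. For $t:\mathbb R^n\to\mathbb R$, $b:\mathsf{Pred}(\mathbb R^n)$ and $T:\mathcal D'(\mathbb R^n)$ there are terms $\mathsf{lift}(t)$, $\mathbb 1_b(t)$, $\frac{\partial T}{\partial x_i}$ of type $\mathcal D'(\mathbb R^n)$, with $$\langle[\![\mathsf{lift}(t)]\!],\varphi\rangle=\int_{\mathbb R^n}[\![t]\!](x)\,\varphi(x)\,dx,\qquad \langle[\![\mathbb 1_b(t)]\!],\varphi\rangle=\int_{[\![b]\!]}[\![t]\!](x)\,\varphi(x)\,dx,\qquad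 \Big\langle\Big[\!\Big[\tfrac{\partial T}{\partial x_i}\Big]\!\Big],\varphi\Big\rangle=-\Big\langle[\![T]\!],\tfrac{\partial\varphi}{\partial x_i}\Big\rangle ;$$ moreover sums and scalar multiples of distributions, application $\langle T,\varphi\rangle$, Dirac distributions $\delta_t$, and bump functions $\varphi^n(c,r)$, with $x\mapsto\prod_i e^{-1/(1-((x_i-c_i)/r)^2)}$ on $\{x:|x_i-c_i|<r\text{ for all }i\}$ and $0$ elsewhere. **The source calculus.** The smooth $\lambda$-calculus has types $\tau::=\mathbb R\mid\tau\times\tau\mid\tau\to\tau$ and the terms of the simply typed $\lambda$-calculus with pairs, both $\mathsf{let}$ forms, real constants, $+$, $\cdot$, $\varsigma$ and $f(t_1,\dots,t_n)$ for every $n$ and every smooth $f:\mathbb R^n\to\mathbb R$. It is embedded in $\lambda_\delta$ by the identity translation. Its dual-number transformation is $\mathcal D(\mathbb R)=\mathbb R\times\mathbb R$, $\mathcal D(\sigma\times\tau)=\mathcal D(\sigma)\times\mathcal D(\tau)$, $\mathcal D(\sigma\to\tau)=\mathcal D(\sigma)\to\mathcal D(\tau)$ on types, and on terms it commutes with variables,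 pairs, $\mathsf{let}$, abstraction and application, while $$\begin{aligned}\mathcal D(c)&=(c,0),\\ \mathcal D(t+u)&=\mathsf{let}\,(x,x')=\mathcal D(t)\,\mathsf{in}\,\mathsf{let}\,(y,y')=\mathcal D(u)\,\mathsf{in}\,(x+y,\;x'+y'),\\ \mathcal D(t\cdot u)&=\mathsf{let}\,(x,x')=\mathcal D(t)\,\mathsf{in}\,\mathsf{let}\,(y,y')=\mathcal D(u)\,\mathsf{in}\,(x\cdot y,\;x\cdot y'+x'\cdot y),\\ \mathcal D(\varsigma(t))&=\mathsf{let}\,(x,x')=\mathcal D(t)\,\mathsf{in}\,\mathsf{let}\,y=\varsigma(x)\,\mathsf{in}\,(y,\;x'\cdot(y\cdot(1-y))),\\ \mathcal D(f(t_1,\dots,t_n))&=\Big(f(\pi_1\mathcal D(t_1),\dots,\pi_1\mathcal D(t_n)),\ \sum_{i=1}^n(\partial_i f)(\pi_1\mathcal D(t_1),\dots,\pi_1\mathcal D(t_n))\cdot\pi_2\mathcal D(t_i)\Big).\end{aligned}$$ **Theorem.** Let $x:\mathbb R\vdash t:\mathbb R$ be a well-typed term of the smooth $\lambda$-calculus,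 so that $x:\mathbb R\times\mathbb R\vdash\mathcal D(t):\mathbb R\times\mathbb R$. Put $$t_1=\lambda x.\,\pi_1(\mathcal D(t)(x,1)),\qquad t_2=\lambda x.\,\pi_2(\mathcal D(t)(x,1)),$$ closed terms of type $\mathbb R\to\mathbb R$, where $\mathcal D(t)(x,1)$ is $\mathcal D(t)$, as a function of its free variable, applied to the pair $(x,1)$. Then, in $\lambda_\delta$, as morphisms $1\to\mathcal D'(\mathbb R)\times\mathcal D'(\mathbb R)$ of $\mathbf{Diff}$, $$\Big[\!\Big[\Big(\mathsf{lift}(\lambda x.t),\ \tfrac{\partial}{\partial x}\big(\mathsf{lift}(\lambda x.t)\big)\Big)\Big]\!\Big]=[\![(\mathsf{lift}(t_1),\ \mathsf{lift}(t_2))]\!].$$ -/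

import Mathlib

open Diffeology MeasureTheory TopologicalSpace
open scoped ContDiff Distributions Topology LineDeriv

set_option linter.unusedVariables false

noncomputable section

namespace LamDelta

/-! ### Diffeological spaces and smooth maps -/

/-- A bundled diffeological space (object of the category `Diff`). -/
structure DSp where
  carrier : Type
  [str : DiffeologicalSpace carrier]

instance : CoeSort DSp Type := ⟨DSp.carrier⟩

instance (X : DSp) : DiffeologicalSpace X := X.str

/-- Morphisms of `Diff`. -/
@[ext]
structure DMap (X Y : DSp) where
  toFun : X → Y
  smooth : DSmooth toFun

instance (X Y : DSp) : CoeFun (DMap X Y) (fun _ => X → Y) := ⟨DMap.toFun⟩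

/-- The real line with its standard diffeology. -/
abbrev DSp.real : DSp := ⟨ℝ⟩

/-- The subspace diffeology along a map `f`: `p` is a plot iff `f ∘ p` is. -/
@[reducible]
def inducedDiff {X Y : Type} [DiffeologicalSpace Y] (f : X → Y) : DiffeologicalSpace X where
  plots _ := {p | IsPlot (f ∘ p)}
  constant_plots x := isPlot_const (x := f x)
  plot_reparam hp hf := isPlot_reparam (X := Y) hp hf
  locality {n p} h := DiffeologicalSpace.locality (X := Y) fun x => by
    obtain ⟨u, hu, hx, H⟩ := h x
    exact ⟨u, hu, hx, fun hfu hf => H hfu hf⟩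

/-- The product of diffeological spaces. -/
@[reducible]
def prodDiff (X Y : Type) [DiffeologicalSpace X] [DiffeologicalSpace Y] :
    DiffeologicalSpace (X × Y) where
  plots _ := {p | IsPlot (fun s => (p s).1) ∧ IsPlot (fun s => (p s).2)}
  constant_plots x := ⟨isPlot_const, isPlot_const⟩
  plot_reparam hp hf := ⟨isPlot_reparam hp.1 hf, isPlot_reparam hp.2 hf⟩
  locality {n p} h := by
    constructor
    · refine DiffeologicalSpace.locality (X := X) fun x => ?_
      obtain ⟨u, hu, hx, H⟩ := h x
      exact ⟨u, hu, hx, fun hfu hf => (H hfu hf).1⟩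
    · refine DiffeologicalSpace.locality (X := Y) fun x => ?_
      obtain ⟨u, hu, hx, H⟩ := h x
      exact ⟨u, hu, hx, fun hfu hf => (H hfu hf).2⟩

def DSp.prod (X Y : DSp) : DSp := { carrier := X × Y, str := prodDiff X Y }

/-- The internal hom of `Diff`: `p : ℝⁿ → Diff(X, Y)` is a plot iff `(u, x) ↦ p u x` is smooth
on `ℝⁿ × X`. -/
@[reducible]
def homDiff (X Y : DSp) : DiffeologicalSpace (DMap X Y) where
  plots n := {p | ∀ (m : ℕ) (r : EuclideanSpace ℝ (Fin m) → EuclideanSpace ℝ (Fin n))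
    (q : EuclideanSpace ℝ (Fin m) → X), ContDiff ℝ ∞ r → IsPlot q →
      IsPlot (fun s => p (r s) (q s))}
  constant_plots f := fun _ _ q _ hq => f.smooth _ q hq
  plot_reparam hp hf := fun m r q hr hq => hp m _ q (hf.comp hr) hq
  locality {n p} h := fun m r q hr hq => by
    refine DiffeologicalSpace.locality (X := Y) fun s => ?_
    obtain ⟨u, hu, hx, H⟩ := h (r s)
    refine ⟨r ⁻¹' u, hu.preimage hr.continuous, hx, fun {l f} hfu hf => ?_⟩
    exact H hfu (hr.comp hf) l id (q ∘ f) contDiff_id (isPlot_reparam hq hf)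

def DSp.hom (X Y : DSp) : DSp := { carrier := DMap X Y, str := homDiff X Y }

instance (X Y : DSp) : CoeFun (X.hom Y) (fun _ => X → Y) := ⟨DMap.toFun⟩

/-- The diffeology whose plots are the constant functions. -/
@[reducible]
def constDiff (X : Type) : DiffeologicalSpace X :=
  .ofCorePlotsOn {
    isPlotOn := fun {_ u} _ p => ∀ s ∈ u, ∀ᶠ t in 𝓝 s, p t = p s
    isPlotOn_congr := fun {n u} hu p q h => by
      have key : ∀ s ∈ u, ∀ᶠ t in 𝓝 s, p t = q t := fun s hs => by
        filter_upwards [hu.mem_nhds hs] with t ht using h ht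
      constructor
      · intro H s hs
        filter_upwards [H s hs, key s hs] with t h1 h2
        rw [← h2, h1, h hs]
      · intro H s hs
        filter_upwards [H s hs, key s hs] with t h1 h2
        rw [h2, h1, h hs]
    isPlot := fun p => ∃ x, ∀ s, p s = x
    isPlotOn_univ := fun {n p} => by
      constructor
      · intro h
        have hl : IsLocallyConstant p := by
          rw [IsLocallyConstant.iff_eventually_eq]
          exact fun s => h s trivial
        exact ⟨p 0, fun s => hl.apply_eq_of_preconnectedSpace s 0⟩
      · rintro ⟨x, hx⟩ s _
        exact Filter.Eventually.of_forall fun t => by rw [hx, hx]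
    isPlot_const := fun x => ⟨x, fun _ => rfl⟩
    isPlotOn_reparam := fun {n m u v hu} hv {p f} hm hp hf s hs =>
      (hf.continuousOn.continuousAt (hv.mem_nhds hs)).eventually (hp _ (hm hs))
    locality := fun {n u} hu {p} h s hs => by
      obtain ⟨v, hv, hsv, H⟩ := h s hs
      exact H s hsv }

/-- The one-point space. -/
def DSp.unit : DSp := { carrier := Unit, str := constDiff Unit }

/-- The natural numbers: the countable coproduct of points. -/
def DSp.nat : DSp := { carrier := ℕ, str := constDiff ℕ }

/-- The positive reals, as a subspace of `ℝ`. -/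
def DSp.posReal : DSp := { carrier := {r : ℝ // 0 < r}, str := inducedDiff Subtype.val }

/-- `E k` is the Euclidean space `ℝ^(k+1)`; all dimensions of the calculus are positive. -/
abbrev E (k : ℕ) : Type := EuclideanSpace ℝ (Fin (k + 1))

/-- Measurable predicates on `ℝ^(k+1)`, with the constant diffeology. -/
def DSp.pred (k : ℕ) : DSp :=
  { carrier := {A : Set (E k) // MeasurableSet A}, str := constDiff _ }

/-! ### Test functions and distributions -/

/-- Test functions on `ℝ^(k+1)`. -/
abbrev TestFn (k : ℕ) : Type := 𝓓((⊤ : Opens (E k)), ℝ)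

/-- The diffeology of the space of test functions: a family `p` of test functions is a plot iff
`(s, x) ↦ p s x` is smooth and, locally in `s`, the supports lie in a common compact set. -/
@[reducible]
def testDiff (k : ℕ) : DiffeologicalSpace (TestFn k) :=
  .ofCorePlotsOn {
    isPlotOn := fun {n u} _ p => ∀ s ∈ u,
      (∀ x : E k, ContDiffAt ℝ ∞
        (fun z : EuclideanSpace ℝ (Fin n) × E k => p z.1 z.2) (s, x)) ∧
      ∃ K : Set (E k), IsCompact K ∧ ∀ᶠ t in 𝓝 s, tsupport (p t) ⊆ K
    isPlotOn_congr := fun {n u} hu p q h => by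
      have main : ∀ p q : EuclideanSpace ℝ (Fin n) → TestFn k, Set.EqOn p q u →
          (∀ s ∈ u, (∀ x : E k, ContDiffAt ℝ ∞
            (fun z : EuclideanSpace ℝ (Fin n) × E k => p z.1 z.2) (s, x)) ∧
            ∃ K : Set (E k), IsCompact K ∧ ∀ᶠ t in 𝓝 s, tsupport (p t) ⊆ K) →
          (∀ s ∈ u, (∀ x : E k, ContDiffAt ℝ ∞
            (fun z : EuclideanSpace ℝ (Fin n) × E k => q z.1 z.2) (s, x)) ∧
            ∃ K : Set (E k), IsCompact K ∧ ∀ᶠ t in 𝓝 s, tsupport (q t) ⊆ K) := by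
        intro p q h H s hs
        obtain ⟨h1, K, hK, h2⟩ := H s hs
        refine ⟨fun x => (h1 x).congr_of_eventuallyEq ?_, K, hK, ?_⟩
        · filter_upwards [continuous_fst.continuousAt.preimage_mem_nhds
            (x := (s, x)) (hu.mem_nhds hs)] with z hz
          rw [h hz]
        · filter_upwards [h2, hu.mem_nhds hs] with t ht htu
          rwa [← h htu]
      exact ⟨main p q h, main q p h.symm⟩
    isPlot := fun {n} p =>
      ContDiff ℝ ∞ (fun z : EuclideanSpace ℝ (Fin n) × E k => p z.1 z.2) ∧
      ∀ s, ∃ K : Set (E k), IsCompact K ∧ ∀ᶠ t in 𝓝 s, tsupport (p t) ⊆ K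
    isPlotOn_univ := fun {n p} => by
      constructor
      · intro h
        exact ⟨contDiff_iff_contDiffAt.2 fun z => (h z.1 trivial).1 z.2,
          fun s => (h s trivial).2⟩
      · rintro ⟨h1, h2⟩ s _
        exact ⟨fun x => h1.contDiffAt, h2 s⟩
    isPlot_const := fun {n} φ =>
      ⟨φ.contDiff.comp contDiff_snd,
        fun _ => ⟨tsupport φ, φ.hasCompactSupport, Filter.Eventually.of_forall fun _ => subset_rfl⟩⟩
    isPlotOn_reparam := fun {n m u v hu} hv {p f} hm hp hf s hs => by
      obtain ⟨h1, K, hK, h2⟩ := hp _ (hm hs)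
      have hfs : ContDiffAt ℝ ∞ f s := hf.contDiffAt (hv.mem_nhds hs)
      refine ⟨fun x => ?_, K, hK, hfs.continuousAt.eventually h2⟩
      exact ContDiffAt.comp (s, x)
        (f := fun z : EuclideanSpace ℝ (Fin m) × E k => (f z.1, z.2)) (h1 x)
        ((ContDiffAt.comp (s, x) (f := Prod.fst) hfs contDiffAt_fst).prodMk contDiffAt_snd)
    locality := fun {n u} hu {p} h s hs => by
      obtain ⟨v, hv, hsv, H⟩ := h s hs
      exact H s hsv }

def DSp.test (k : ℕ) : DSp := { carrier := TestFn k, str := testDiff k }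

/-- Distributions on `ℝ^(k+1)`: continuous linear functionals on test functions, cut out as a
subobject of the internal hom `DSp.test k ⇒ ℝ`. -/
structure Dist (k : ℕ) where
  toCLM : 𝓓'((⊤ : Opens (E k)), ℝ)
  smooth : DSmooth (X := DSp.test k) (Y := ℝ) fun φ => toCLM φ

/-- The underlying morphism of a distribution. -/
def Dist.toDMap {k : ℕ} (T : Dist k) : DMap (DSp.test k) DSp.real :=
  ⟨fun φ => T.toCLM φ, T.smooth⟩

def DSp.dist (k : ℕ) : DSp :=
  { carrier := Dist k
    str := letI := homDiff (DSp.test k) DSp.real; inducedDiff Dist.toDMap }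

/-! ### Structural morphisms of `Diff` -/

namespace DMap

variable {X Y Z : DSp}

def comp (g : DMap Y Z) (f : DMap X Y) : DMap X Z := ⟨fun x => g (f x), g.smooth.comp f.smooth⟩

def const (X : DSp) {Y : DSp} (y : Y) : DMap X Y := ⟨fun _ => y, fun _ _ _ => isPlot_const⟩

def fst : DMap (X.prod Y) X := ⟨Prod.fst, fun _ _ hp => hp.1⟩

def snd : DMap (X.prod Y) Y := ⟨Prod.snd, fun _ _ hp => hp.2⟩

def pair (f : DMap X Y) (g : DMap X Z) : DMap X (Y.prod Z) :=
  ⟨fun x => (f x, g x), fun n p hp => ⟨f.smooth n p hp, g.smooth n p hp⟩⟩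

def eval : DMap ((X.hom Y).prod X) Y :=
  ⟨fun z => z.1 z.2, fun n _ hp => hp.1 n id _ contDiff_id hp.2⟩

/-- Currying; contexts grow on the left. -/
def curry (f : DMap (Y.prod X) Z) : DMap X (Y.hom Z) :=
  ⟨fun x => ⟨fun y => f (y, x), fun n q hq => f.smooth n _ ⟨hq, isPlot_const⟩⟩,
    fun _ _ hp m _ _ hr hq => f.smooth m _ ⟨hq, isPlot_reparam hp hr⟩⟩

/-- Postcomposition of `n` real-valued maps with a smooth function `ℝⁿ → ℝ`. -/
def prim {n : ℕ} (f : (Fin n → ℝ) → ℝ) (hf : ContDiff ℝ ∞ f) (g : Fin n → DMap X DSp.real) :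
    DMap X DSp.real :=
  ⟨fun x => f fun i => g i x, fun m p hp => by
    have h : ContDiff ℝ ∞ fun s => fun i => g i (p s) :=
      contDiff_pi.2 fun i => ((g i).smooth m p hp : IsPlot (X := ℝ) _).contDiff
    exact (hf.comp h).isPlot⟩

def add (f g : DMap X DSp.real) : DMap X DSp.real :=
  ⟨fun x => (f x + g x : ℝ), fun m p hp =>
    (((f.smooth m p hp : IsPlot (X := ℝ) _).contDiff).add
      ((g.smooth m p hp : IsPlot (X := ℝ) _).contDiff)).isPlot⟩

def mul (f g : DMap X DSp.real) : DMap X DSp.real :=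
  ⟨fun x => (f x * g x : ℝ), fun m p hp =>
    (((f.smooth m p hp : IsPlot (X := ℝ) _).contDiff).mul
      ((g.smooth m p hp : IsPlot (X := ℝ) _).contDiff)).isPlot⟩

def sigmoid (f : DMap X DSp.real) : DMap X DSp.real :=
  ⟨fun x => Real.sigmoid (f x), fun m p hp =>
    ((contDiff_sigmoid.of_le le_top).comp
      ((f.smooth m p hp : IsPlot (X := ℝ) _).contDiff)).isPlot⟩

def posAdd (f g : DMap X DSp.posReal) : DMap X DSp.posReal :=
  ⟨fun x => ⟨(f x).1 + (g x).1, add_pos (f x).2 (g x).2⟩, fun m p hp =>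
    ((show IsPlot (X := ℝ) fun s => (f (p s)).1 from f.smooth m p hp).contDiff.add
      (show IsPlot (X := ℝ) fun s => (g (p s)).1 from g.smooth m p hp).contDiff).isPlot (X := ℝ)⟩

def posMul (f g : DMap X DSp.posReal) : DMap X DSp.posReal :=
  ⟨fun x => ⟨(f x).1 * (g x).1, mul_pos (f x).2 (g x).2⟩, fun m p hp =>
    ((show IsPlot (X := ℝ) fun s => (f (p s)).1 from f.smooth m p hp).contDiff.mul
      (show IsPlot (X := ℝ) fun s => (g (p s)).1 from g.smooth m p hp).contDiff).isPlot (X := ℝ)⟩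

/-- Every function out of a space with the constant diffeology is smooth. -/
theorem dSmooth_of_constDiff {A B : Type} [DiffeologicalSpace B] (f : A → B) :
    @DSmooth A B (constDiff A) _ f := by
  intro n p hp
  obtain ⟨x, hx⟩ := hp
  have : f ∘ p = fun _ => f x := funext fun s => congrArg f (hx s)
  rw [this]
  exact isPlot_const

def succ : DMap DSp.nat DSp.nat :=
  ⟨Nat.succ, letI := constDiff ℕ; dSmooth_of_constDiff (B := ℕ) Nat.succ⟩

/-- The recursor of the natural numbers, `(x, f) ↦ (n ↦ fⁿ x)`. -/
def iter (X : DSp) : DMap (X.prod (X.hom X)) (DSp.nat.hom X) :=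
  ⟨fun z => ⟨fun n : ℕ => (fun x => z.2 x)^[n] z.1, dSmooth_of_constDiff _⟩, by
    intro n p hp m r q hr hq
    obtain ⟨N, hN⟩ := hq
    have key : ∀ j : ℕ, IsPlot (X := X) fun s => (fun x => (p (r s)).2 x)^[j] (p (r s)).1 := by
      intro j
      induction j with
      | zero => exact isPlot_reparam hp.1 hr
      | succ j ih =>
        simp only [Function.iterate_succ_apply']
        exact hp.2 m r _ hr ih
    have h := key N
    have e : (fun s => (fun x => (p (r s)).2 x)^[N] (p (r s)).1) =
        fun s => (fun x => (p (r s)).2 x)^[q s] (p (r s)).1 :=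
      funext fun s => by rw [hN s]
    rw [e] at h
    exact h⟩

end DMap

/-! ### The types of the calculus and their interpretation -/

/-- The types of `λ_δ`. `pred k`, `dist k`, `test k` stand for `Pred(ℝ^(k+1))`, `𝓓'(ℝ^(k+1))`
and `𝓓(ℝ^(k+1))`. -/
inductive Ty : Type
  | real : Ty
  | posReal : Ty
  | pred (k : ℕ) : Ty
  | nat : Ty
  | prod (σ τ : Ty) : Ty
  | dist (k : ℕ) : Ty
  | test (k : ℕ) : Ty
  | arr (σ τ : Ty) : Ty

/-- `Ty.pow k` is `ℝ^(k+1) = ℝ × (ℝ × ⋯)`; in particular `Ty.pow 0 = ℝ`. -/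
def Ty.pow : ℕ → Ty
  | 0 => .real
  | k + 1 => .prod .real (Ty.pow k)

def Ty.sem : Ty → DSp
  | .real => DSp.real
  | .posReal => DSp.posReal
  | .pred k => DSp.pred k
  | .nat => DSp.nat
  | .prod σ τ => σ.sem.prod τ.sem
  | .dist k => DSp.dist k
  | .test k => DSp.test k
  | .arr σ τ => σ.sem.hom τ.sem

/-- The coordinates of an element of `⟦ℝ^(k+1)⟧`. -/
def coord : (k : ℕ) → (Ty.pow k).sem → Fin (k + 1) → ℝ
  | 0, x => fun _ => x
  | k + 1, x => Fin.cons (α := fun _ => ℝ) x.1 (coord k x.2)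

/-- The element of `⟦ℝ^(k+1)⟧` with given coordinates. -/
def ofCoord : (k : ℕ) → (Fin (k + 1) → ℝ) → (Ty.pow k).sem
  | 0, v => v 0
  | k + 1, v => (v 0, ofCoord k (Fin.tail v))

/-- The canonical bijection `⟦ℝ^(k+1)⟧ → E k`. -/
def toE (k : ℕ) (x : (Ty.pow k).sem) : E k := WithLp.toLp 2 (coord k x)

/-- The canonical bijection `E k → ⟦ℝ^(k+1)⟧`. -/
def ofE (k : ℕ) (x : E k) : (Ty.pow k).sem := ofCoord k fun i => x i

theorem isPlot_coord (k : ℕ) {n : ℕ} {p : EuclideanSpace ℝ (Fin n) → (Ty.pow k).sem}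
    (hp : IsPlot p) (i : Fin (k + 1)) : ContDiff ℝ ∞ fun s => coord k (p s) i := by
  induction k with
  | zero => exact (show IsPlot (X := ℝ) p from hp).contDiff
  | succ k ih =>
    refine Fin.cases ?_ (fun j => ?_) i
    · exact (show IsPlot (X := ℝ) fun s => (p s).1 from hp.1).contDiff
    · exact ih (p := fun s => (p s).2) hp.2 j

theorem isPlot_ofCoord (k : ℕ) {n : ℕ} {v : EuclideanSpace ℝ (Fin n) → Fin (k + 1) → ℝ}
    (hv : ∀ i, ContDiff ℝ ∞ fun s => v s i) : IsPlot fun s => ofCoord k (v s) := by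
  induction k with
  | zero => exact (hv 0).isPlot
  | succ k ih => exact ⟨(hv 0).isPlot, ih (v := fun s => Fin.tail (v s)) fun i => hv i.succ⟩

theorem contDiff_toE (k : ℕ) {n : ℕ} {p : EuclideanSpace ℝ (Fin n) → (Ty.pow k).sem}
    (hp : IsPlot p) : ContDiff ℝ ∞ fun s => toE k (p s) :=
  contDiff_euclidean.2 fun i => isPlot_coord k hp i

theorem isPlot_ofE (k : ℕ) {n : ℕ} {v : EuclideanSpace ℝ (Fin n) → E k}
    (hv : ContDiff ℝ ∞ v) : IsPlot fun s => ofE k (v s) :=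
  isPlot_ofCoord k fun i => contDiff_euclidean.1 hv i

/-- An element of `⟦ℝ^(k+1) → ℝ⟧` as a function on Euclidean space. -/
def onE (k : ℕ) (f : (Ty.arr (Ty.pow k) .real).sem) (x : E k) : ℝ :=
  DMap.toFun (X := (Ty.pow k).sem) (Y := DSp.real) f (ofE k x)

/-- Maps `⟦ℝ^(k+1)⟧ → ℝ` in `Diff` are smooth in the usual sense, jointly in a parameter. -/
theorem contDiff_of_isPlot_hom (k : ℕ) {n : ℕ}
    {p : EuclideanSpace ℝ (Fin n) → (Ty.arr (Ty.pow k) .real).sem} (hp : IsPlot p) :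
    ContDiff ℝ ∞ fun z : EuclideanSpace ℝ (Fin n) × E k =>
      onE k (p z.1) z.2 := by
  let e := toEuclidean (E := EuclideanSpace ℝ (Fin n) × E k)
  have h := hp _ (fun s => (e.symm s).1) (fun s => ofE k (e.symm s).2)
    (contDiff_fst.comp e.symm.contDiff) (isPlot_ofE k (contDiff_snd.comp e.symm.contDiff))
  have h2 := (show IsPlot (X := ℝ) _ from h).contDiff.comp e.contDiff
  have e1 : ∀ z, e.symm (e z) = z := e.symm_apply_apply
  have e2 : (fun z : EuclideanSpace ℝ (Fin n) × E k => onE k (p z.1) z.2) =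
      (fun s => onE k (p (e.symm s).1) (e.symm s).2) ∘ e := by
    funext z
    simp only [Function.comp_apply, e1]
  rw [e2]
  exact h2

theorem contDiff_hom (k : ℕ) (f : (Ty.arr (Ty.pow k) .real).sem) :
    ContDiff ℝ ∞ (onE k f) := by
  have h : IsPlot (fun _ : EuclideanSpace ℝ (Fin 0) => f) := isPlot_const
  exact (contDiff_of_isPlot_hom k h).comp (contDiff_prodMk_right (0 : EuclideanSpace ℝ (Fin 0)))

/-! ### The distribution-theoretic morphisms -/

/-- The regular distribution `T_{1_A f}`, that is `φ ↦ ∫_A f φ`. -/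
def regCLM {k : ℕ} (A : Set (E k)) (f : E k → ℝ) : 𝓓'((⊤ : Opens (E k)), ℝ) :=
  TestFunction.integralAgainstBilinCLM (ContinuousLinearMap.mul ℝ ℝ) volume (A.indicator f)

theorem regCLM_apply {k : ℕ} {A : Set (E k)} (hA : MeasurableSet A) {f : E k → ℝ}
    (hf : Continuous f) (φ : TestFn k) : regCLM A f φ = ∫ x, φ x * A.indicator f x := by
  have h : LocallyIntegrableOn (A.indicator f) ((⊤ : Opens (E k)) : Set (E k)) volume :=
    (hf.locallyIntegrable.indicator hA).locallyIntegrableOn _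
  exact TestFunction.integralAgainstBilinCLM_eq_integral h

/-- Smoothness of integrals depending on a parameter. -/
theorem contDiff_integral {k n : ℕ} {A : Set (E k)} (hA : MeasurableSet A)
    {g : EuclideanSpace ℝ (Fin n) → E k → ℝ}
    (hg : ContDiff ℝ ∞ fun z : EuclideanSpace ℝ (Fin n) × E k => g z.1 z.2)
    (hK : ∀ s, ∃ K : Set (E k), IsCompact K ∧ ∀ᶠ t in 𝓝 s, ∀ x, x ∉ K → g t x = 0) :
    ContDiff ℝ ∞ fun s => ∫ x, A.indicator (g s) x := by
  rw [contDiff_iff_contDiffAt]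
  intro s
  obtain ⟨K, hK, hs⟩ := hK s
  obtain ⟨u, hu, huo, hsu⟩ := eventually_nhds_iff.1 hs
  have hone : LocallyIntegrable (A.indicator fun _ => (1 : ℝ)) (volume : Measure (E k)) :=
    (continuous_const.locallyIntegrable).indicator hA
  have hneg : ContDiff ℝ ∞ fun z : EuclideanSpace ℝ (Fin n) × E k => (z.1, -z.2) :=
    contDiff_fst.prodMk contDiff_snd.neg
  have h := contDiffOn_convolution_right_with_param_comp (𝕜 := ℝ) (n := (⊤ : ℕ∞)) (μ := volume)
    (ContinuousLinearMap.mul ℝ ℝ) (s := u) (v := fun _ => (0 : E k)) contDiffOn_const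
    (f := A.indicator fun _ => (1 : ℝ)) (g := fun t x => g t (-x)) (k := -K) huo hK.neg
    (fun t x ht hx => hu t ht (-x) fun h => hx (by simpa using h)) hone
    (hg.comp hneg).contDiffOn
  have h2 := h.contDiffAt (huo.mem_nhds hsu)
  refine h2.congr_of_eventuallyEq (Filter.Eventually.of_forall fun t => ?_)
  simp only [convolution]
  refine integral_congr_ae (Filter.Eventually.of_forall fun x => ?_)
  by_cases hx : x ∈ A <;> simp [hx]

theorem isPlot_regCLM {k n : ℕ} {A : Set (E k)} (hA : MeasurableSet A)
    {f : EuclideanSpace ℝ (Fin n) → E k → ℝ}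
    (hf : ContDiff ℝ ∞ fun z : EuclideanSpace ℝ (Fin n) × E k => f z.1 z.2)
    {φ : EuclideanSpace ℝ (Fin n) → TestFn k} (hφ : IsPlot (X := DSp.test k) φ) :
    IsPlot (X := ℝ) fun s => regCLM A (f s) (φ s) := by
  have hfs : ∀ s, Continuous (f s) := fun s => hf.continuous.comp 
    (by fun_prop : Continuous fun x => (s, x))
  have e : (fun s => regCLM A (f s) (φ s)) =
      fun s => ∫ x, A.indicator (fun x => φ s x * f s x) x := by
    funext s
    refine (regCLM_apply hA (hfs s) _).trans ?_
    refine integral_congr_ae (Filter.Eventually.of_forall fun x => ?_)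
    by_cases hx : x ∈ A <;> simp [hx]
  rw [e]
  refine (contDiff_integral hA (hφ.1.mul hf) fun s => ?_).isPlot
  obtain ⟨K, hK, h⟩ := hφ.2 s
  refine ⟨K, hK, h.mono fun t ht x hx => ?_⟩
  have : φ t x = 0 := image_eq_zero_of_notMem_tsupport fun h => hx (ht h)
  simp only [this, zero_mul]

/-- `T_{1_A f}` as an element of `⟦𝓓'(ℝ^(k+1))⟧`. -/
def reg {k : ℕ} (A : (DSp.pred k)) (f : (Ty.arr (Ty.pow k) .real).sem) : DSp.dist k where
  toCLM := regCLM A.1 (onE k f)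
  smooth _ _ hp := isPlot_regCLM A.2
    (f := fun _ => onE k f)
    ((contDiff_hom k f).comp contDiff_snd) hp

/-- The indicator construction `(A, f) ↦ T_{1_A f}`. -/
def indMap (k : ℕ) : DMap ((DSp.pred k).prod (Ty.arr (Ty.pow k) .real).sem) (DSp.dist k) :=
  ⟨fun z => reg z.1 z.2, by
    intro n p hp m r q hr hq
    obtain ⟨A, hA⟩ := hp.1
    have h := isPlot_regCLM (k := k) (A := A.1) A.2 (f := fun s => onE k (p (r s)).2)
      (contDiff_of_isPlot_hom k (isPlot_reparam hp.2 hr)) hq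
    have e : ∀ s, p (r s) = (A, (p (r s)).2) := fun s => Prod.ext (hA (r s)) rfl
    have e2 : (fun s => (reg (p (r s)).1 (p (r s)).2).toDMap (q s)) =
        fun s => (reg A (p (r s)).2).toDMap (q s) := by
      funext s
      rw [e s]
    exact (congrArg (fun F => IsPlot (X := ℝ) F) e2).mpr h⟩

/-- `lift`: the smooth map `f ↦ T_f`. -/
def liftMap (k : ℕ) : DMap (Ty.arr (Ty.pow k) .real).sem (DSp.dist k) :=
  (indMap k).comp ((DMap.const _ (Y := DSp.pred k) (⟨Set.univ, MeasurableSet.univ⟩ :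
    {A : Set (E k) // MeasurableSet A})).pair ⟨id, dSmooth_id⟩)

/-- Evaluation of a distribution at a test function. -/
def appMap (k : ℕ) : DMap ((DSp.dist k).prod (DSp.test k)) DSp.real :=
  ⟨fun z => z.1.toCLM z.2, fun n _ hp => hp.1 n id _ contDiff_id hp.2⟩

/-- The partial derivative `∂_i φ` of a test function. -/
def testDeriv {k : ℕ} (i : Fin (k + 1)) (φ : TestFn k) : TestFn k :=
  ∂_{(EuclideanSpace.single i (1 : ℝ) : E k)} φ

theorem isPlot_testDeriv {k n : ℕ} (i : Fin (k + 1)) {p : EuclideanSpace ℝ (Fin n) → TestFn k}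
    (hp : IsPlot (X := DSp.test k) p) : IsPlot (X := DSp.test k) fun s => testDeriv i (p s) := by
  set v : E k := EuclideanSpace.single i (1 : ℝ) with hv
  have hval : ∀ (φ : TestFn k) (x : E k), testDeriv i φ x = fderiv ℝ φ x v := fun φ x => by
    have h1 : testDeriv i φ x = lineDeriv ℝ φ x v :=
      TestFunction.lineDerivCLM_apply_of_le (n := ⊤) (k := ⊤) (by simp)
    rw [h1, (φ.contDiff.differentiable (by simp)).differentiableAt.lineDeriv_eq_fderiv]
  refine ⟨?_, fun s => ?_⟩
  · have e : (fun z : EuclideanSpace ℝ (Fin n) × E k => testDeriv i (p z.1) z.2) =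
        fun z => fderiv ℝ (fun z : EuclideanSpace ℝ (Fin n) × E k => p z.1 z.2) z
          (0, v) := by
      funext z
      rw [hval]
      have hd : DifferentiableAt ℝ
          (fun z : EuclideanSpace ℝ (Fin n) × E k => p z.1 z.2) z :=
        (hp.1.differentiable (by simp)).differentiableAt
      have hc := hd.hasFDerivAt.comp z.2 (f := fun x => (z.1, x)) (hasFDerivAt_prodMk_right z.1 z.2)
      have h2 : fderiv ℝ (p z.1) z.2 = _ := hc.fderiv
      rw [h2]
      simp
    exact (congrArg (fun F => ContDiff ℝ ∞ F) e).mpr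
      ((hp.1.fderiv_right (m := ∞) (by simp)).clm_apply contDiff_const)
  · obtain ⟨K, hK, h⟩ := hp.2 s
    refine ⟨K, hK, h.mono fun t ht => subset_trans ?_ ht⟩
    have e : (testDeriv i (p t) : E k → ℝ) = fun x => fderiv ℝ (p t) x v :=
      funext fun x => hval (p t) x
    rw [e]
    exact tsupport_fderiv_apply_subset ℝ v

/-- The distributional partial derivative, `⟨∂T/∂x_i, φ⟩ = -⟨T, ∂φ/∂x_i⟩`. -/
def derivMap (k : ℕ) (i : Fin (k + 1)) : DMap (DSp.dist k) (DSp.dist k) :=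
  ⟨fun T => ⟨∂_{(EuclideanSpace.single i (1 : ℝ) : E k)} T.toCLM, fun n p hp =>
      ((T.smooth n _ (isPlot_testDeriv i hp) : IsPlot (X := ℝ) _).contDiff.neg).isPlot⟩,
    fun n p hp m r q hr hq =>
      ((hp m r _ hr (isPlot_testDeriv i hq) : IsPlot (X := ℝ) _).contDiff.neg).isPlot⟩

/-- Addition of distributions. -/
def addMap (k : ℕ) : DMap ((DSp.dist k).prod (DSp.dist k)) (DSp.dist k) :=
  ⟨fun z => ⟨z.1.toCLM + z.2.toCLM, fun n p hp =>
      ((z.1.smooth n p hp : IsPlot (X := ℝ) _).contDiff.add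
        (z.2.smooth n p hp : IsPlot (X := ℝ) _).contDiff).isPlot⟩,
    fun n p hp m r q hr hq =>
      ((hp.1 m r q hr hq : IsPlot (X := ℝ) _).contDiff.add
        (hp.2 m r q hr hq : IsPlot (X := ℝ) _).contDiff).isPlot⟩

/-- Multiplication of a distribution by a scalar. -/
def smulMap (k : ℕ) : DMap (DSp.real.prod (DSp.dist k)) (DSp.dist k) :=
  ⟨fun z => ⟨(z.1 : ℝ) • z.2.toCLM, fun n p hp =>
      ((contDiff_const (c := (z.1 : ℝ))).mul
        (z.2.smooth n p hp : IsPlot (X := ℝ) _).contDiff).isPlot⟩,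
    fun n p hp m r q hr hq =>
      ((isPlot_reparam (X := ℝ) hp.1 hr).contDiff.mul
        (hp.2 m r q hr hq : IsPlot (X := ℝ) _).contDiff).isPlot⟩

/-- The Dirac distribution `u ↦ δ_u`. -/
def diracMap (k : ℕ) : DMap (Ty.pow k).sem (DSp.dist k) :=
  ⟨fun u => ⟨Distribution.delta (toE k u), fun n p hp =>
      (hp.1.comp (contDiff_id.prodMk contDiff_const)).isPlot⟩,
    fun n p hp m r q hr hq =>
      (hq.1.comp (contDiff_id.prodMk (contDiff_toE k (isPlot_reparam hp hr)))).isPlot⟩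

/-- The one-dimensional bump function with centre `c` and radius `r`. -/
def bump1 (c r x : ℝ) : ℝ :=
  if c - r < x ∧ x < c + r then Real.exp (-(1 / (1 - ((x - c) / r) ^ 2))) else 0

theorem bump1_eq (c : ℝ) {r : ℝ} (hr : 0 < r) (x : ℝ) :
    bump1 c r x = expNegInvGlue (1 - ((x - c) / r) ^ 2) := by
  have h : (c - r < x ∧ x < c + r) ↔ 0 < 1 - ((x - c) / r) ^ 2 := by
    rw [sub_pos, sq_lt_one_iff_abs_lt_one, abs_lt, div_lt_one hr, lt_div_iff₀ hr]
    constructor <;> rintro ⟨h1, h2⟩ <;> constructor <;> linarith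
  unfold bump1 expNegInvGlue
  by_cases hx : c - r < x ∧ x < c + r
  · rw [if_pos hx, if_neg (not_le.2 (h.1 hx)), one_div]
  · rw [if_neg hx, if_pos (not_lt.1 fun h' => hx (h.2 h'))]

/-- The bump function on `ℝ^(k+1)`: the product of the one-dimensional ones. -/
def bumpFn {k : ℕ} (c : E k) (r : ℝ) (x : E k) : ℝ := ∏ i, bump1 (c i) r (x i)

theorem bumpFn_eq_zero {k : ℕ} {c : E k} {r : ℝ} {x : E k} {R : ℝ}
    (hx : x ∉ WithLp.ofLp ⁻¹' Set.pi Set.univ fun _ : Fin (k + 1) => Set.Icc (-R) R)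
    (hR : ∀ i, |c i| + r ≤ R) : bumpFn c r x = 0 := by
  simp only [Set.mem_preimage, Set.mem_pi, Set.mem_univ, true_implies, not_forall] at hx
  obtain ⟨i, hi⟩ := hx
  refine Finset.prod_eq_zero (Finset.mem_univ i) (if_neg fun h => hi ?_)
  have := hR i
  have h1 := neg_abs_le (c i)
  have h2 := le_abs_self (c i)
  exact ⟨by linarith [h.1], by linarith [h.2]⟩

theorem isCompact_box (k : ℕ) (R : ℝ) :
    IsCompact (WithLp.ofLp ⁻¹' Set.pi Set.univ fun _ : Fin (k + 1) => Set.Icc (-R) R :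
      Set (E k)) :=
  (PiLp.homeomorph 2 fun _ : Fin (k + 1) => ℝ).isCompact_preimage.2
    (isCompact_univ_pi fun _ => isCompact_Icc)

theorem contDiff_bumpFn {k : ℕ} {X : Type} [NormedAddCommGroup X] [NormedSpace ℝ X]
    {c : X → E k} {r : X → ℝ} (hc : ContDiff ℝ ∞ c) (hr : ContDiff ℝ ∞ r) (h0 : ∀ s, 0 < r s) :
    ContDiff ℝ ∞ fun z : X × E k => bumpFn (c z.1) (r z.1) z.2 := by
  refine contDiff_prod fun i _ => ?_
  simp only [bump1_eq _ (h0 _)]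
  refine expNegInvGlue.contDiff.comp (contDiff_const.sub (ContDiff.pow ?_ 2))
  have hx : ContDiff ℝ ∞ fun z : X × E k => z.2 i := contDiff_euclidean.1 contDiff_snd i
  have hci : ContDiff ℝ ∞ fun z : X × E k => c z.1 i :=
    contDiff_euclidean.1 (hc.comp contDiff_fst) i
  exact (hx.sub hci).div (hr.comp contDiff_fst) fun z => (h0 _).ne'

theorem tsupport_bumpFn {k : ℕ} {c : E k} {r R : ℝ} (hR : ∀ i, |c i| + r ≤ R) :
    tsupport (bumpFn c r) ⊆
      WithLp.ofLp ⁻¹' Set.pi Set.univ fun _ : Fin (k + 1) => Set.Icc (-R) R := by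
  refine closure_minimal (fun x hx => ?_) (isCompact_box k R).isClosed
  by_contra h
  exact hx (bumpFn_eq_zero h hR)

/-- The bump function as a test function. -/
def bump {k : ℕ} (c : E k) (r : ℝ) (hr : 0 < r) : TestFn k where
  toFun := bumpFn c r
  contDiff' := (contDiff_bumpFn (X := ℝ) (c := fun _ => c) (r := fun _ => r) contDiff_const
    contDiff_const fun _ => hr).comp (contDiff_prodMk_right (0 : ℝ))
  hasCompactSupport' := (isCompact_box k (∑ i, |c i| + r)).of_isClosed_subset
    (isClosed_tsupport _) (tsupport_bumpFn fun i => by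
      gcongr
      exact Finset.single_le_sum (f := fun i => |c i|) (fun _ _ => abs_nonneg _)
        (Finset.mem_univ i))
  tsupport_subset' := Set.subset_univ _

/-- The smooth map `(c, r) ↦ φ_r^c`. -/
def bumpMap (k : ℕ) : DMap ((Ty.pow k).sem.prod DSp.posReal) (DSp.test k) :=
  ⟨fun z => bump (toE k z.1) z.2.1 z.2.2, by
    intro n p hp
    have hc : ContDiff ℝ ∞ fun s => toE k (p s).1 := contDiff_toE k hp.1
    have hr : ContDiff ℝ ∞ fun s => (p s).2.1 :=
      (show IsPlot (X := ℝ) fun s => (p s).2.1 from hp.2).contDiff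
    refine ⟨contDiff_bumpFn hc hr fun s => (p s).2.2, fun s => ?_⟩
    have hcont : Continuous fun t => ∑ i, |toE k (p t).1 i| + (p t).2.1 :=
      (continuous_finsetSum _ fun i _ =>
        ((contDiff_euclidean.1 hc i).continuous.abs)).add hr.continuous
    refine ⟨_, isCompact_box k (∑ i, |toE k (p s).1 i| + (p s).2.1 + 1), ?_⟩
    filter_upwards [hcont.continuousAt.eventually (gt_mem_nhds (lt_add_one _))] with t ht
    refine tsupport_bumpFn fun i => le_trans ?_ (le_of_lt ht)
    gcongr
    exact Finset.single_le_sum (f := fun i => |toE k (p t).1 i|) (fun _ _ => abs_nonneg _)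
      (Finset.mem_univ i)⟩

/-! ### Terms of `λ_δ` and their semantics -/

/-- Typed de Bruijn variables: `Var Γ τ` is a position in the context `Γ` with type `τ`. -/
inductive Var {T : Type} : List T → T → Type
  | vz {Γ : List T} {τ : T} : Var (τ :: Γ) τ
  | vs {Γ : List T} {σ τ : T} (x : Var Γ τ) : Var (σ :: Γ) τ

/-- Typing derivations `Γ ⊢ t : τ` of `λ_δ`. In `letPair`, `let (x, y) = t in u`, the variable `y`
is the most recent one. Predicates are comparisons `λ x : ℝ^(k+1). t < u` and `λ x. t ≤ u` and
their Boolean combinations. -/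
inductive Tm : List Ty → Ty → Type
  | var {Γ : List Ty} {τ : Ty} (x : Var Γ τ) : Tm Γ τ
  | const {Γ : List Ty} (r : ℝ) : Tm Γ .real
  | add {Γ : List Ty} (t u : Tm Γ .real) : Tm Γ .real
  | mul {Γ : List Ty} (t u : Tm Γ .real) : Tm Γ .real
  | sigmoid {Γ : List Ty} (t : Tm Γ .real) : Tm Γ .real
  | prim {Γ : List Ty} {n : ℕ} (f : (Fin n → ℝ) → ℝ) (hf : ContDiff ℝ ∞ f)
      (t : Fin n → Tm Γ .real) : Tm Γ .real
  | posConst {Γ : List Ty} (r : ℝ) (hr : 0 < r) : Tm Γ .posReal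
  | posAdd {Γ : List Ty} (t u : Tm Γ .posReal) : Tm Γ .posReal
  | posMul {Γ : List Ty} (t u : Tm Γ .posReal) : Tm Γ .posReal
  | zero {Γ : List Ty} : Tm Γ .nat
  | succ {Γ : List Ty} (t : Tm Γ .nat) : Tm Γ .nat
  | iter {Γ : List Ty} {τ : Ty} (t : Tm Γ τ) (u : Tm Γ (.arr τ τ)) : Tm Γ (.arr .nat τ)
  | pair {Γ : List Ty} {σ τ : Ty} (t : Tm Γ σ) (u : Tm Γ τ) : Tm Γ (.prod σ τ)
  | letPair {Γ : List Ty} {σ τ ρ : Ty} (t : Tm Γ (.prod σ τ)) (u : Tm (τ :: σ :: Γ) ρ) : Tm Γ ρ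
  | letIn {Γ : List Ty} {σ τ : Ty} (t : Tm Γ σ) (u : Tm (σ :: Γ) τ) : Tm Γ τ
  | lam {Γ : List Ty} {σ τ : Ty} (t : Tm (σ :: Γ) τ) : Tm Γ (.arr σ τ)
  | app {Γ : List Ty} {σ τ : Ty} (t : Tm Γ (.arr σ τ)) (u : Tm Γ σ) : Tm Γ τ
  | lt {Γ : List Ty} {k : ℕ} (t u : Tm [Ty.pow k] .real) : Tm Γ (.pred k)
  | le {Γ : List Ty} {k : ℕ} (t u : Tm [Ty.pow k] .real) : Tm Γ (.pred k)
  | not {Γ : List Ty} {k : ℕ} (b : Tm Γ (.pred k)) : Tm Γ (.pred k)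
  | and {Γ : List Ty} {k : ℕ} (b c : Tm Γ (.pred k)) : Tm Γ (.pred k)
  | or {Γ : List Ty} {k : ℕ} (b c : Tm Γ (.pred k)) : Tm Γ (.pred k)
  | lift {Γ : List Ty} {k : ℕ} (t : Tm Γ (.arr (Ty.pow k) .real)) : Tm Γ (.dist k)
  | ind {Γ : List Ty} {k : ℕ} (b : Tm Γ (.pred k)) (t : Tm Γ (.arr (Ty.pow k) .real)) :
      Tm Γ (.dist k)
  | deriv {Γ : List Ty} {k : ℕ} (i : Fin (k + 1)) (t : Tm Γ (.dist k)) : Tm Γ (.dist k)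
  | dAdd {Γ : List Ty} {k : ℕ} (t u : Tm Γ (.dist k)) : Tm Γ (.dist k)
  | dSmul {Γ : List Ty} {k : ℕ} (a : Tm Γ .real) (t : Tm Γ (.dist k)) : Tm Γ (.dist k)
  | dApp {Γ : List Ty} {k : ℕ} (t : Tm Γ (.dist k)) (u : Tm Γ (.test k)) : Tm Γ .real
  | bump {Γ : List Ty} {k : ℕ} (c : Tm Γ (Ty.pow k)) (r : Tm Γ .posReal) : Tm Γ (.test k)
  | dirac {Γ : List Ty} {k : ℕ} (t : Tm Γ (Ty.pow k)) : Tm Γ (.dist k)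

/-- The interpretation of contexts. -/
def ctxSem : List Ty → DSp
  | [] => DSp.unit
  | τ :: Γ => τ.sem.prod (ctxSem Γ)

def Var.sem : {Γ : List Ty} → {τ : Ty} → Var Γ τ → DMap (ctxSem Γ) τ.sem
  | _, _, .vz => DMap.fst
  | _, _, .vs x => (Var.sem x).comp DMap.snd

/-- The element of `⟦ℝ^(k+1)⟧`, seen as an environment for a one-variable context. -/
def envOf (k : ℕ) (x : E k) : ctxSem [Ty.pow k] := (ofE k x, ())

theorem measurable_sem {k : ℕ} (f : DMap (ctxSem [Ty.pow k]) DSp.real) :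
    Measurable fun x : E k => (f (envOf k x) : ℝ) := by
  let e := toEuclidean (E := E k)
  have hp : IsPlot (X := ctxSem [Ty.pow k]) fun s => envOf k (e.symm s) :=
    ⟨isPlot_ofE k e.symm.contDiff, isPlot_const (X := DSp.unit)⟩
  have h : Continuous fun s => (f (envOf k (e.symm s)) : ℝ) :=
    (show IsPlot (X := ℝ) _ from f.smooth _ _ hp).contDiff.continuous
  have h2 := h.comp e.continuous
  have e2 : (fun x : E k => (f (envOf k x) : ℝ)) =
      (fun s => (f (envOf k (e.symm s)) : ℝ)) ∘ e := by
    funext x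
    simp only [Function.comp_apply, e.symm_apply_apply]
  rw [e2]
  exact h2.measurable

def ltPred {k : ℕ} (f g : DMap (ctxSem [Ty.pow k]) DSp.real) :
    {A : Set (E k) // MeasurableSet A} :=
  ⟨{x | (f (envOf k x) : ℝ) < (g (envOf k x) : ℝ)},
    measurableSet_lt (measurable_sem f) (measurable_sem g)⟩

def lePred {k : ℕ} (f g : DMap (ctxSem [Ty.pow k]) DSp.real) :
    {A : Set (E k) // MeasurableSet A} :=
  ⟨{x | (f (envOf k x) : ℝ) ≤ (g (envOf k x) : ℝ)},
    measurableSet_le (measurable_sem f) (measurable_sem g)⟩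

/-- A Boolean operation on predicates, as a morphism. -/
def predOp {X : DSp} {k : ℕ} (op : {A : Set (E k) // MeasurableSet A} →
    {A : Set (E k) // MeasurableSet A} → {A : Set (E k) // MeasurableSet A})
    (f g : DMap X (DSp.pred k)) : DMap X (DSp.pred k) :=
  ⟨fun x => op (f x) (g x), fun n p hp => by
    obtain ⟨A, hA⟩ := f.smooth n p hp
    obtain ⟨B, hB⟩ := g.smooth n p hp
    exact ⟨op A B, fun s => congrArg₂ op (hA s) (hB s)⟩⟩

/-- The denotational semantics of `λ_δ` in `Diff`. -/
def Tm.sem : {Γ : List Ty} → {τ : Ty} → Tm Γ τ → DMap (ctxSem Γ) τ.sem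
  | _, _, .var x => x.sem
  | _, _, .const r => DMap.const _ (Y := DSp.real) r
  | _, _, .add t u => t.sem.add u.sem
  | _, _, .mul t u => t.sem.mul u.sem
  | _, _, .sigmoid t => t.sem.sigmoid
  | _, _, .prim f hf t => DMap.prim f hf fun i => (t i).sem
  | _, _, .posConst r hr => DMap.const _ (Y := DSp.posReal) (⟨r, hr⟩ : {r : ℝ // 0 < r})
  | _, _, .posAdd t u => t.sem.posAdd u.sem
  | _, _, .posMul t u => t.sem.posMul u.sem
  | _, _, .zero => DMap.const _ (Y := DSp.nat) (0 : ℕ)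
  | _, _, .succ t => DMap.succ.comp t.sem
  | _, _, .iter t u => (DMap.iter _).comp (t.sem.pair u.sem)
  | _, _, .pair t u => t.sem.pair u.sem
  | _, _, .letPair t u =>
      u.sem.comp ((DMap.snd.comp t.sem).pair ((DMap.fst.comp t.sem).pair ⟨id, dSmooth_id⟩))
  | _, _, .letIn t u => u.sem.comp (t.sem.pair ⟨id, dSmooth_id⟩)
  | _, _, .lam t => t.sem.curry
  | _, _, .app t u => DMap.eval.comp (t.sem.pair u.sem)
  | _, _, .lt (k := k) t u => DMap.const _ (Y := DSp.pred k) (ltPred t.sem u.sem)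
  | _, _, .le (k := k) t u => DMap.const _ (Y := DSp.pred k) (lePred t.sem u.sem)
  | _, _, .not b => predOp (fun A _ => ⟨A.1ᶜ, A.2.compl⟩) b.sem b.sem
  | _, _, .and b c => predOp (fun A B => ⟨A.1 ∩ B.1, A.2.inter B.2⟩) b.sem c.sem
  | _, _, .or b c => predOp (fun A B => ⟨A.1 ∪ B.1, A.2.union B.2⟩) b.sem c.sem
  | _, _, .lift t => (liftMap _).comp t.sem
  | _, _, .ind b t => (indMap _).comp (b.sem.pair t.sem)
  | _, _, .deriv i t => (derivMap _ i).comp t.sem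
  | _, _, .dAdd t u => (addMap _).comp (t.sem.pair u.sem)
  | _, _, .dSmul a t => (smulMap _).comp (a.sem.pair t.sem)
  | _, _, .dApp t u => (appMap _).comp (t.sem.pair u.sem)
  | _, _, .bump c r => (bumpMap _).comp (c.sem.pair r.sem)
  | _, _, .dirac t => (diracMap _).comp t.sem

/-! ### The smooth `λ`-calculus, its embedding and its dual-number transformation -/

namespace Src

/-- The types of the smooth `λ`-calculus. -/
inductive Ty : Type
  | real : Ty
  | prod (σ τ : Ty) : Ty
  | arr (σ τ : Ty) : Ty

/-- The type transformation `𝒟`. -/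
def Ty.dual : Ty → Ty
  | .real => .prod .real .real
  | .prod σ τ => .prod σ.dual τ.dual
  | .arr σ τ => .arr σ.dual τ.dual

/-- The identity translation of types. -/
def Ty.embed : Ty → LamDelta.Ty
  | .real => .real
  | .prod σ τ => .prod σ.embed τ.embed
  | .arr σ τ => .arr σ.embed τ.embed

/-- Typing derivations of the smooth `λ`-calculus. The primitives are constants, sum, product and
sigmoid, and every smooth function `f : ℝⁿ → ℝ` of any arity `n`. -/
inductive Tm : List Ty → Ty → Type
  | var {Γ : List Ty} {τ : Ty} (x : Var Γ τ) : Tm Γ τ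
  | const {Γ : List Ty} (r : ℝ) : Tm Γ .real
  | add {Γ : List Ty} (t u : Tm Γ .real) : Tm Γ .real
  | mul {Γ : List Ty} (t u : Tm Γ .real) : Tm Γ .real
  | sigmoid {Γ : List Ty} (t : Tm Γ .real) : Tm Γ .real
  | prim {Γ : List Ty} {n : ℕ} (f : (Fin n → ℝ) → ℝ) (hf : ContDiff ℝ ∞ f)
      (t : Fin n → Tm Γ .real) : Tm Γ .real
  | pair {Γ : List Ty} {σ τ : Ty} (t : Tm Γ σ) (u : Tm Γ τ) : Tm Γ (.prod σ τ)
  | letPair {Γ : List Ty} {σ τ ρ : Ty} (t : Tm Γ (.prod σ τ)) (u : Tm (τ :: σ :: Γ) ρ) : Tm Γ ρ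
  | letIn {Γ : List Ty} {σ τ : Ty} (t : Tm Γ σ) (u : Tm (σ :: Γ) τ) : Tm Γ τ
  | lam {Γ : List Ty} {σ τ : Ty} (t : Tm (σ :: Γ) τ) : Tm Γ (.arr σ τ)
  | app {Γ : List Ty} {σ τ : Ty} (t : Tm Γ (.arr σ τ)) (u : Tm Γ σ) : Tm Γ τ

/-- Images of variables under a map of types, for `𝒟` and for the embedding. -/
def mapVar {S T : Type} (f : S → T) : {Γ : List S} → {τ : S} → Var Γ τ → Var (Γ.map f) (f τ)
  | _, _, .vz => .vz
  | _, _, .vs x => .vs (mapVar f x)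

/-- The identity translation into `λ_δ`. -/
def Tm.embed : {Γ : List Ty} → {τ : Ty} → Tm Γ τ → LamDelta.Tm (Γ.map Ty.embed) τ.embed
  | _, _, .var x => .var (mapVar Ty.embed x)
  | _, _, .const r => .const r
  | _, _, .add t u => .add t.embed u.embed
  | _, _, .mul t u => .mul t.embed u.embed
  | _, _, .sigmoid t => .sigmoid t.embed
  | _, _, .prim f hf t => .prim f hf fun i => (t i).embed
  | _, _, .pair t u => .pair t.embed u.embed
  | _, _, .letPair t u => .letPair t.embed u.embed
  | _, _, .letIn t u => .letIn t.embed u.embed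
  | _, _, .lam t => .lam t.embed
  | _, _, .app t u => .app t.embed u.embed

/-- Renamings of variables. -/
def Ren (Γ Δ : List Ty) : Type := ∀ τ : Ty, Var Γ τ → Var Δ τ

/-- A renaming extended under a binder. -/
def Ren.under {Γ Δ : List Ty} (ρ : Ren Γ Δ) (σ : Ty) : Ren (σ :: Γ) (σ :: Δ)
  | _, .vz => .vz
  | _, .vs x => .vs (ρ _ x)

def Tm.rename : {Γ Δ : List Ty} → {τ : Ty} → Ren Γ Δ → Tm Γ τ → Tm Δ τ
  | _, _, _, ρ, .var x => .var (ρ _ x)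
  | _, _, _, _, .const r => .const r
  | _, _, _, ρ, .add t u => .add (t.rename ρ) (u.rename ρ)
  | _, _, _, ρ, .mul t u => .mul (t.rename ρ) (u.rename ρ)
  | _, _, _, ρ, .sigmoid t => .sigmoid (t.rename ρ)
  | _, _, _, ρ, .prim f hf t => .prim f hf fun i => (t i).rename ρ
  | _, _, _, ρ, .pair t u => .pair (t.rename ρ) (u.rename ρ)
  | _, _, _, ρ, .letPair t u => .letPair (t.rename ρ) (u.rename ((ρ.under _).under _))
  | _, _, _, ρ, .letIn t u => .letIn (t.rename ρ) (u.rename (ρ.under _))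
  | _, _, _, ρ, .lam t => .lam (t.rename (ρ.under _))
  | _, _, _, ρ, .app t u => .app (t.rename ρ) (u.rename ρ)

/-- Weakening by one fresh variable. -/
def Tm.weaken {Γ : List Ty} {τ : Ty} (σ : Ty) (t : Tm Γ τ) : Tm (σ :: Γ) τ :=
  t.rename fun _ x => .vs x

/-- The first projection, `let (x, y) = t in x`. -/
def Tm.fst {Γ : List Ty} {σ τ : Ty} (t : Tm Γ (.prod σ τ)) : Tm Γ σ := .letPair t (.var (.vs .vz))

/-- The second projection, `let (x, y) = t in y`. -/
def Tm.snd {Γ : List Ty} {σ τ : Ty} (t : Tm Γ (.prod σ τ)) : Tm Γ τ := .letPair t (.var .vz)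

/-- The sum of finitely many real terms. -/
def Tm.sum {Γ : List Ty} : (n : ℕ) → (Fin n → Tm Γ .real) → Tm Γ .real
  | 0, _ => .const 0
  | n + 1, t => .add (t 0) (Tm.sum n fun i => t i.succ)

/-- The partial derivative `∂_i f` of a function on `ℝⁿ`. -/
def partialDeriv {n : ℕ} (f : (Fin n → ℝ) → ℝ) (i : Fin n) (v : Fin n → ℝ) : ℝ :=
  fderiv ℝ f v (Pi.single i 1)

theorem contDiff_partialDeriv {n : ℕ} {f : (Fin n → ℝ) → ℝ} (hf : ContDiff ℝ ∞ f) (i : Fin n) :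
    ContDiff ℝ ∞ (partialDeriv f i) :=
  (hf.fderiv_right (m := ∞) (by simp)).clm_apply contDiff_const

/-- The dual-number forward-mode transformation `𝒟` on terms:
* `𝒟(c) = (c, 0)`;
* `𝒟(t + u) = let (x, x') = 𝒟(t) in let (y, y') = 𝒟(u) in (x + y, x' + y')`;
* `𝒟(t * u) = let (x, x') = 𝒟(t) in let (y, y') = 𝒟(u) in (x * y, x * y' + x' * y)`;
* `𝒟(ς(t)) = let (x, x') = 𝒟(t) in let y = ς(x) in (y, x' * (y * (1 - y)))`;
* `𝒟(f(t₁, …, tₙ)) = (f(π₁ 𝒟(t₁), …, π₁ 𝒟(tₙ)), ∑ᵢ ∂ᵢf(π₁ 𝒟(t₁), …, π₁ 𝒟(tₙ)) * π₂ 𝒟(tᵢ))`;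
* `𝒟` commutes with all other term formers. -/
def Tm.dual : {Γ : List Ty} → {τ : Ty} → Tm Γ τ → Tm (Γ.map Ty.dual) τ.dual
  | _, _, .var x => .var (mapVar Ty.dual x)
  | _, _, .const r => .pair (.const r) (.const 0)
  | _, _, .add t u =>
      .letPair t.dual (.letPair ((u.dual.weaken _).weaken _)
        (.pair (.add (.var (.vs (.vs (.vs .vz)))) (.var (.vs .vz)))
          (.add (.var (.vs (.vs .vz))) (.var .vz))))
  | _, _, .mul t u =>
      .letPair t.dual (.letPair ((u.dual.weaken _).weaken _)
        (.pair (.mul (.var (.vs (.vs (.vs .vz)))) (.var (.vs .vz)))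
          (.add (.mul (.var (.vs (.vs (.vs .vz)))) (.var .vz))
            (.mul (.var (.vs (.vs .vz))) (.var (.vs .vz))))))
  | _, _, .sigmoid t =>
      .letPair t.dual (.letIn (.sigmoid (.var (.vs .vz)))
        (.pair (.var .vz) (.mul (.var (.vs .vz))
          (.mul (.var .vz) (.add (.const 1) (.mul (.const (-1)) (.var .vz)))))))
  | _, _, .prim (n := n) f hf t =>
      .pair (.prim f hf fun i => (t i).dual.fst)
        (Tm.sum n fun i =>
          .mul (.prim (partialDeriv f i) (contDiff_partialDeriv hf i) fun j => (t j).dual.fst)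
            (t i).dual.snd)
  | _, _, .pair t u => .pair t.dual u.dual
  | _, _, .letPair t u => .letPair t.dual u.dual
  | _, _, .letIn t u => .letIn t.dual u.dual
  | _, _, .lam t => .lam t.dual
  | _, _, .app t u => .app t.dual u.dual

/-- For `x : ℝ ⊢ t : ℝ`, the term `x : ℝ ⊢ 𝒟(t)(x, 1) : ℝ × ℝ`, that is, `𝒟(t)` (as a function of
its free variable) applied to `(x, 1)`. -/
def dualAt (t : Tm [Ty.real] .real) : Tm [Ty.real] (.prod .real .real) :=
  .app (Tm.weaken .real (Γ := []) (.lam (σ := Ty.dual .real) (τ := Ty.dual .real) t.dual))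
    (.pair (.var .vz) (.const 1))

/-- `t₁ = λ x. π₁ (𝒟(t)(x, 1))`, as a closed term of `λ_δ`. -/
def primalPart (t : Tm [Ty.real] .real) : LamDelta.Tm [] (.arr .real .real) :=
  Tm.embed (Γ := []) (.lam (dualAt t).fst)

/-- `t₂ = λ x. π₂ (𝒟(t)(x, 1))`, as a closed term of `λ_δ`. -/
def tangentPart (t : Tm [Ty.real] .real) : LamDelta.Tm [] (.arr .real .real) :=
  Tm.embed (Γ := []) (.lam (dualAt t).snd)

/-- `λ x. t`, as a closed term of `λ_δ`. -/
def embedFun (t : Tm [Ty.real] .real) : LamDelta.Tm [] (.arr .real .real) :=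
  Tm.embed (Γ := []) (.lam t)

end Src

end LamDelta

end

/-! The statement splits into a fact about the smooth calculus and a fact about distributions.

On the calculus side, `t` may pass through higher types even though its input and output are real,
so a plain induction on terms cannot state correctness of 𝒟. A logical relation does it instead.
`DualRel` compares curves in the meaning of a type with curves in the meaning of its dual-number
type. At the reals it demands that the second curve be the first one paired with its derivative; at
arrows it demands that related argument curves be sent to related result curves. The curves are
arbitrary functions on the line: only differentiability at the type of reals is ever used, so no
plot condition enters. The fundamental lemma `Tm.dualRel` says that every term preserves the
relation; its content lies in the primitives, where it is the sum, product and chain rule. Applied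
to the identity curve, whose dual is `s ↦ (s, 1)`, it shows that `t₁` denotes the same function as
`λ x. t` and that `t₂` denotes its classical derivative (`Tm.dualAt_spec`).

On the distribution side, `derivMap_liftMap` shows that the weak derivative of the regular
distribution of a smooth function is the regular distribution of its classical derivative. This is
integration by parts against a test function, whose compact support removes the boundary term. -/

namespace LamDelta

namespace Src

/-! ### The logical relation for dual numbers. -/

/-- `g` consists of the values and the derivatives of `f`. -/
def IsDual (f : ℝ → ℝ) (g : ℝ → ℝ × ℝ) : Prop :=
  ∀ s, (g s).1 = f s ∧ HasDerivAt f (g s).2 s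

/-- The logical relation between curves in `⟦τ⟧` and curves in `⟦𝒟(τ)⟧`: at the type of real
numbers, the second curve consists of the first one and its derivative. -/
def DualRel : (τ : Ty) → (ℝ → τ.embed.sem) → (ℝ → τ.dual.embed.sem) → Prop
  | .real, f, g => IsDual f g
  | .prod σ τ, f, g => DualRel σ (fun s => (f s).1) (fun s => (g s).1) ∧
      DualRel τ (fun s => (f s).2) (fun s => (g s).2)
  | .arr σ τ, F, G => ∀ (f : ℝ → σ.embed.sem) (g : ℝ → σ.dual.embed.sem), DualRel σ f g →
      DualRel τ (fun s => DMap.toFun (X := σ.embed.sem) (Y := τ.embed.sem) (F s) (f s))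
        (fun s => DMap.toFun (X := σ.dual.embed.sem) (Y := τ.dual.embed.sem) (G s) (g s))

/-- The extension of `DualRel` to environments. -/
def DualRelCtx : (Γ : List Ty) → (ℝ → ctxSem (Γ.map Ty.embed)) →
    (ℝ → ctxSem ((Γ.map Ty.dual).map Ty.embed)) → Prop
  | [], _, _ => True
  | τ :: Γ, γ, δ => DualRel τ (fun s => (γ s).1) (fun s => (δ s).1) ∧
      DualRelCtx Γ (fun s => (γ s).2) (fun s => (δ s).2)

/-! ### Values of terms and their behaviour under renaming. -/

/-- The value of a term of the smooth `λ`-calculus in an environment. -/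
noncomputable def Tm.val {Γ : List Ty} {τ : Ty} (t : Tm Γ τ) (γ : ctxSem (Γ.map Ty.embed)) : τ.embed.sem :=
  t.embed.sem γ

/-- `Tm.val` at the type of real numbers. -/
noncomputable def Tm.realVal {Γ : List Ty} (t : Tm Γ .real) (γ : ctxSem (Γ.map Ty.embed)) : ℝ := t.val γ

/-- `Tm.val` at the type of dual numbers. -/
noncomputable def Tm.dualVal {Γ : List Ty} (t : Tm Γ (Ty.dual .real)) (γ : ctxSem (Γ.map Ty.embed)) : ℝ × ℝ :=
  t.val γ

/-- The value of a variable of the smooth `λ`-calculus in an environment. -/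
noncomputable def valVar {Γ : List Ty} {τ : Ty} (x : Var Γ τ) (γ : ctxSem (Γ.map Ty.embed)) : τ.embed.sem :=
  (mapVar Ty.embed x).sem γ

/-- `γ` is the reindexing of the environment `δ` along the renaming `ρ`. -/
def Ren.Compat {Γ Δ : List Ty} (ρ : Ren Γ Δ) (γ : ctxSem (Γ.map Ty.embed))
    (δ : ctxSem (Δ.map Ty.embed)) : Prop :=
  ∀ (τ : Ty) (x : Var Γ τ), valVar (ρ τ x) δ = valVar x γ

theorem Ren.Compat.under {Γ Δ : List Ty} {ρ : Ren Γ Δ} {γ : ctxSem (Γ.map Ty.embed)}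
    {δ : ctxSem (Δ.map Ty.embed)} (h : ρ.Compat γ δ) (σ : Ty) (a : σ.embed.sem) :
    (ρ.under σ).Compat (a, γ) (a, δ)
  | _, .vz => rfl
  | _, .vs x => h _ x

/-- Needed because 𝒟 of a sum or product places the second dual term under two new binders, so it is
weakened twice. The target context, the renaming and both environments stay universally quantified
in the induction, since binders change all of them. -/
theorem Tm.val_rename {Γ : List Ty} {τ : Ty} (t : Tm Γ τ) : ∀ {Δ : List Ty} {ρ : Ren Γ Δ}
    {γ : ctxSem (Γ.map Ty.embed)} {δ : ctxSem (Δ.map Ty.embed)}, ρ.Compat γ δ →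
    (t.rename ρ).val δ = t.val γ := by
  induction t with
  | var x => exact fun h => h _ x
  | const r => exact fun _ => rfl
  | add t u iht ihu => exact fun h => congrArg₂ (fun a b : ℝ => a + b) (iht h) (ihu h)
  | mul t u iht ihu => exact fun h => congrArg₂ (fun a b : ℝ => a * b) (iht h) (ihu h)
  | sigmoid t iht => exact fun h => congrArg Real.sigmoid (iht h)
  | prim f hf t iht => exact fun h => congrArg f (funext fun i => iht i h)
  | pair t u iht ihu => exact fun h => Prod.ext (iht h) (ihu h)
  | @letPair Γ σ τ υ t u iht ihu =>
    intro Δ ρ γ δ h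
    have e := iht h
    -- The second component is pushed last, as the most recent variable. Both environments are
    -- extended by the values of the original `t`; rewriting with `e` turns these into the values of
    -- the renamed term.
    have h' := ihu ((h.under σ (t.val γ).1).under τ (t.val γ).2)
    refine Eq.trans ?_ h'
    rw [← e]
    rfl
  | @letIn Γ σ τ t u iht ihu =>
    intro Δ ρ γ δ h
    have e := iht h
    have h' := ihu (h.under σ (t.val γ))
    refine Eq.trans ?_ h'
    rw [← e]
    rfl
  | lam t iht => exact fun h => DMap.ext (funext fun a => iht (h.under _ a))
  | app t u iht ihu =>
    intro Δ ρ γ δ h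
    exact congrArg₂ (fun (F : DMap _ _) a => F a) (iht h) (ihu h)

theorem Tm.val_weaken {Γ : List Ty} {τ σ : Ty} (t : Tm Γ τ) (γ : ctxSem (Γ.map Ty.embed))
    (a : σ.embed.sem) : (t.weaken σ).val (a, γ) = t.val γ :=
  t.val_rename fun _ _ => rfl

theorem Tm.realVal_sum {Γ : List Ty} (γ : ctxSem (Γ.map Ty.embed)) : (n : ℕ) →
    (t : Fin n → Tm Γ .real) → (Tm.sum n t).realVal γ = ∑ i, (t i).realVal γ
  | 0, _ => rfl
  | n + 1, t => by
    rw [Fin.sum_univ_succ, ← Tm.realVal_sum γ n fun i => t i.succ]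
    rfl

/-! ### The fundamental lemma of the logical relation. -/

theorem DualRelCtx.var {Γ : List Ty} {τ : Ty} (x : Var Γ τ) {γ : ℝ → ctxSem (Γ.map Ty.embed)}
    {δ : ℝ → ctxSem ((Γ.map Ty.dual).map Ty.embed)} (h : DualRelCtx Γ γ δ) :
    DualRel τ (fun s => valVar x (γ s)) (fun s => valVar (mapVar Ty.dual x) (δ s)) := by
  induction x with
  | vz => exact h.1
  | vs x ih => exact ih h.2

/-- Linearity, after expanding `w` in the standard basis. It turns the chain rule into the sum that
𝒟 produces for a primitive. -/
theorem fderiv_eq_sum_partialDeriv {n : ℕ} (f : (Fin n → ℝ) → ℝ) (v w : Fin n → ℝ) :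
    fderiv ℝ f v w = ∑ i, partialDeriv f i v * w i := by
  have h : w = ∑ i, w i • (Pi.single i 1 : Fin n → ℝ) := pi_eq_sum_univ' w
  conv_lhs => rw [h]
  simp only [map_sum, map_smul, smul_eq_mul, partialDeriv]
  exact Finset.sum_congr rfl fun i _ => mul_comm _ _

/-- True by unfolding. Its purpose is to present the values as elements of `ℝ` and `ℝ × ℝ`, so that
the calculus of derivatives applies to them. -/
theorem DualRel.at {Γ Δ : List Ty} {t : Tm Γ .real} {t' : Tm Δ (Ty.dual .real)}
    {γ : ℝ → ctxSem (Γ.map Ty.embed)} {δ : ℝ → ctxSem (Δ.map Ty.embed)}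
    (h : DualRel .real (fun s => t.val (γ s)) (fun s => t'.val (δ s))) (s : ℝ) :
    (t'.dualVal (δ s)).1 = t.realVal (γ s) ∧
      HasDerivAt (fun s => t.realVal (γ s)) (t'.dualVal (δ s)).2 s :=
  h s

/-- Correctness of forward-mode automatic differentiation: the values of `t` and `𝒟(t)` along
related curves of environments are related. -/
theorem Tm.dualRel {Γ : List Ty} {τ : Ty} (t : Tm Γ τ) : ∀ {γ : ℝ → ctxSem (Γ.map Ty.embed)}
    {δ : ℝ → ctxSem ((Γ.map Ty.dual).map Ty.embed)}, DualRelCtx Γ γ δ →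
    DualRel τ (fun s => t.val (γ s)) (fun s => t.dual.val (δ s)) := by
  induction t with
  | var x => exact fun h => h.var x
  | const r => exact fun _ s => ⟨rfl, hasDerivAt_const s r⟩
  | add t u iht ihu =>
    intro γ δ h s
    obtain ⟨ht, ht'⟩ := DualRel.at (iht h) s
    obtain ⟨hu, hu'⟩ := DualRel.at (ihu h) s
    -- In 𝒟 the term for `u` is evaluated below the two variables bound to the components of 𝒟(t),
    -- tangent most recent; its value does not depend on them.
    have e : ((u.dual.weaken .real).weaken .real).dualVal
        ((t.dual.dualVal (δ s)).2, (t.dual.dualVal (δ s)).1, δ s) = u.dual.dualVal (δ s) :=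
      (Tm.val_weaken _ _ _).trans (Tm.val_weaken _ _ _)
    rw [← e] at hu hu'
    exact ⟨congrArg₂ (fun a b : ℝ => a + b) ht hu, ht'.add hu'⟩
  | mul t u iht ihu =>
    intro γ δ h s
    obtain ⟨ht, ht'⟩ := DualRel.at (iht h) s
    obtain ⟨hu, hu'⟩ := DualRel.at (ihu h) s
    have e : ((u.dual.weaken .real).weaken .real).dualVal
        ((t.dual.dualVal (δ s)).2, (t.dual.dualVal (δ s)).1, δ s) = u.dual.dualVal (δ s) :=
      (Tm.val_weaken _ _ _).trans (Tm.val_weaken _ _ _)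
    have hm := ht'.mul hu'
    -- The product rule puts the summand with the derivative of `t` first, while 𝒟 puts it second.
    rw [← ht, ← hu, add_comm, ← e] at hm
    rw [← e] at hu
    exact ⟨congrArg₂ (fun a b : ℝ => a * b) ht hu, hm⟩
  | sigmoid t iht =>
    intro γ δ h s
    obtain ⟨ht, ht'⟩ := DualRel.at (iht h) s
    have hc := (Real.hasDerivAt_sigmoid (t.realVal (γ s))).comp s ht'
    rw [← ht] at hc
    refine ⟨congrArg Real.sigmoid ht, hc.congr_deriv ?_⟩
    -- The calculus has no subtraction, so `1 - y` is encoded as `1 + (-1) * y`.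
    change _ = (t.dual.dualVal (δ s)).2 * (Real.sigmoid (t.dual.dualVal (δ s)).1 *
      (1 + (-1) * Real.sigmoid (t.dual.dualVal (δ s)).1))
    ring
  | prim f hf t iht =>
    intro γ δ h s
    have ht := fun i => DualRel.at (iht i h) s
    have e : (fun i => (t i).realVal (γ s)) = fun i => ((t i).dual.dualVal (δ s)).1 :=
      funext fun i => ((ht i).1).symm
    refine ⟨congrArg f e.symm, ?_⟩
    -- The arguments are assembled into one curve in `ℝⁿ`, so that the chain rule for `f` applies
    -- once.
    have hv : HasDerivAt (fun s => fun i => (t i).realVal (γ s))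
        (fun i => ((t i).dual.dualVal (δ s)).2) s :=
      hasDerivAt_pi.2 fun i => (ht i).2
    have hc := (hf.differentiable (by simp) _).hasFDerivAt.comp_hasDerivAt s hv
    refine hc.congr_deriv ?_
    rw [fderiv_eq_sum_partialDeriv, e]
    exact (Tm.realVal_sum (δ s) _ fun i => .mul (.prim (partialDeriv f i)
      (contDiff_partialDeriv hf i) fun j => (t j).dual.fst) (t i).dual.snd).symm
  | pair t u iht ihu => exact fun h => ⟨iht h, ihu h⟩
  -- From here on 𝒟 commutes with the term former, and the relation was defined so that these cases
  -- are immediate: binders extend the related environments by related curves.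
  | letPair t u iht ihu => exact fun h => ihu ⟨(iht h).2, (iht h).1, h⟩
  | letIn t u iht ihu => exact fun h => ihu ⟨iht h, h⟩
  | lam t iht => exact fun h f g hfg => iht ⟨hfg, h⟩
  | app t u iht ihu => exact fun h => iht h _ _ (ihu h)

/-! ### The primal and tangent parts of a term in one real variable. -/

/-- The function `⟦x : ℝ ⊢ t : ℝ⟧`. -/
noncomputable def Tm.fn (t : Tm [Ty.real] .real) (x : ℝ) : ℝ := t.val (Γ := [Ty.real]) (x, ())

/-- Semantic β-reduction: the abstraction of 𝒟(t) is closed, so weakening it by `x` leaves its value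
unchanged. -/
theorem Tm.val_dualAt (t : Tm [Ty.real] .real) (x : ℝ) :
    (dualAt t).val (Γ := [Ty.real]) (x, ()) =
      t.dual.val (Γ := [Ty.dual .real]) (((x, 1) : ℝ × ℝ), ()) := by
  have e := Tm.val_weaken (Γ := []) (σ := .real)
    (.lam (σ := Ty.dual .real) (τ := Ty.dual .real) t.dual) () x
  exact congrArg (fun F : DMap _ _ => F ((x, 1) : ℝ × ℝ)) e

theorem Tm.dualAt_spec (t : Tm [Ty.real] .real) (x : ℝ) :
    ((dualAt t).val (Γ := [Ty.real]) (x, ())).1 = t.fn x ∧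
      HasDerivAt t.fn ((dualAt t).val (Γ := [Ty.real]) (x, ())).2 x := by
  -- The seed tangent 1 is the derivative of the identity curve.
  have h := t.dualRel (γ := fun s => (s, ())) (δ := fun s => (((s, 1) : ℝ × ℝ), ()))
    ⟨fun s => ⟨rfl, hasDerivAt_id s⟩, trivial⟩ x
  rw [t.val_dualAt]
  exact h

theorem sem_primalPart (t : Tm [Ty.real] .real) : (primalPart t).sem = (embedFun t).sem :=
  DMap.ext (funext fun _ => DMap.ext (funext fun x => (t.dualAt_spec x).1))

theorem hasDerivAt_tangentPart (t : Tm [Ty.real] .real) (x : ℝ) :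
    HasDerivAt (fun y : ℝ => DMap.toFun (X := DSp.real) (Y := DSp.real) ((embedFun t).sem ()) y)
      (DMap.toFun (X := DSp.real) (Y := DSp.real) ((tangentPart t).sem ()) x) x :=
  (t.dualAt_spec x).2

end Src

/-! ### Weak derivatives of regular distributions. -/

theorem Dist.ext_toCLM {k : ℕ} {S T : Dist k} (h : ∀ φ, S.toCLM φ = T.toCLM φ) : S = T := by
  cases S; cases T
  congr
  exact ContinuousLinearMap.ext h

theorem testDeriv_apply {k : ℕ} (i : Fin (k + 1)) (φ : TestFn k) (x : E k) :
    testDeriv i φ x = fderiv ℝ φ x (EuclideanSpace.single i 1) := by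
  have h1 : testDeriv i φ x = lineDeriv ℝ φ x (EuclideanSpace.single i 1) :=
    TestFunction.lineDerivCLM_apply_of_le (n := ⊤) (k := ⊤) (by simp)
  rw [h1, (φ.contDiff.differentiable (by simp)).differentiableAt.lineDeriv_eq_fderiv]

/-- `liftMap` is the indicator construction over the whole space, so the indicator drops out.
Morphisms into the reals are smooth, hence continuous, which gives the local integrability behind
the integral formula. -/
theorem liftMap_apply {k : ℕ} (f : (Ty.arr (Ty.pow k) .real).sem) (φ : TestFn k) :
    (show Dist k from liftMap k f).toCLM φ = ∫ x, φ x * onE k f x := by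
  have h := regCLM_apply MeasurableSet.univ (contDiff_hom k f).continuous φ
  simp only [Set.indicator_univ] at h
  exact h

/-- The distributional derivative of a regular distribution is given by the classical one. -/
theorem derivMap_liftMap {k : ℕ} (i : Fin (k + 1)) (f g : (Ty.arr (Ty.pow k) .real).sem)
    (h : ∀ x, fderiv ℝ (onE k f) x (EuclideanSpace.single i 1) = onE k g x) :
    derivMap k i (liftMap k f) = liftMap k g := by
  refine Dist.ext_toCLM fun φ => ?_
  refine Eq.trans (congrArg Neg.neg (liftMap_apply f (testDeriv i φ))) ?_
  refine Eq.trans ?_ (liftMap_apply g φ).symm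
  have hφ : Continuous φ := φ.contDiff.continuous
  have hf := contDiff_hom k f
  have hg := contDiff_hom k g
  have hφc : HasCompactSupport φ := φ.hasCompactSupport
  have hd : Continuous (testDeriv i φ) := (testDeriv i φ).contDiff.continuous
  have hdc : HasCompactSupport (testDeriv i φ) := (testDeriv i φ).hasCompactSupport
  -- The functions `f` and `g` need not be integrable: each of the three products is continuous and
  -- inherits compact support from `φ` or its derivative. Continuity of the derivative of `f` comes
  -- from `h`, as `g` is itself a morphism.
  have key := integral_mul_fderiv_eq_neg_fderiv_mul_of_integrable (μ := volume)
    (f := φ) (g := onE k f) (v := EuclideanSpace.single i (1 : ℝ))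
    (by
      simp only [← testDeriv_apply]
      exact (hd.mul hf.continuous).integrable_of_hasCompactSupport hdc.mul_right)
    (by
      simp only [h]
      exact (hφ.mul hg.continuous).integrable_of_hasCompactSupport hφc.mul_right)
    ((hφ.mul hf.continuous).integrable_of_hasCompactSupport hφc.mul_right)
    (fun x _ => (φ.contDiff.differentiable (by simp)).differentiableAt)
    (fun x _ => (hf.differentiable (by simp)).differentiableAt)
  simp only [h, ← testDeriv_apply] at key
  exact key.symm

/-- On the one-dimensional Euclidean space, `onE 0 f` is `f` composed with the coordinate
projection, and that projection sends the basis vector to 1. This bridges derivatives on `ℝ` and on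
`E 0`. -/
theorem fderiv_onE_zero {f g : (Ty.arr (Ty.pow 0) .real).sem}
    (h : ∀ x : ℝ, HasDerivAt (fun y : ℝ => DMap.toFun (X := DSp.real) (Y := DSp.real) f y)
      (DMap.toFun (X := DSp.real) (Y := DSp.real) g x) x) (x : E 0) :
    fderiv ℝ (onE 0 f) x (EuclideanSpace.single 0 1) = onE 0 g x := by
  have hp : HasFDerivAt (fun x : E 0 => x 0) (EuclideanSpace.proj (𝕜 := ℝ) (0 : Fin 1)) x :=
    (EuclideanSpace.proj (𝕜 := ℝ) (0 : Fin 1)).hasFDerivAt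
  have h1 := (h (x 0)).comp_hasFDerivAt x hp
  have h2 : fderiv ℝ (onE 0 f) x = _ := h1.fderiv
  rw [h2]
  simp
  rfl

end LamDelta

theorem mainTheorem4 (t : LamDelta.Src.Tm [LamDelta.Src.Ty.real] LamDelta.Src.Ty.real) :
    (LamDelta.Tm.pair
        (LamDelta.Tm.lift (k := 0) (LamDelta.Src.embedFun t))
        (LamDelta.Tm.deriv (k := 0) 0
          (LamDelta.Tm.lift (k := 0) (LamDelta.Src.embedFun t)))).sem =
      (LamDelta.Tm.pair
        (LamDelta.Tm.lift (k := 0) (LamDelta.Src.primalPart t))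
        (LamDelta.Tm.lift (k := 0) (LamDelta.Src.tangentPart t))).sem := by
  -- Morphisms are determined by their underlying functions, so the two components can be compared
  -- at the point of the unit space.
  refine LamDelta.DMap.ext (funext fun _ => Prod.ext ?_ ?_)
  · change LamDelta.liftMap 0 ((LamDelta.Src.embedFun t).sem ()) =
      LamDelta.liftMap 0 ((LamDelta.Src.primalPart t).sem ())
    rw [LamDelta.Src.sem_primalPart]
  · exact LamDelta.derivMap_liftMap (k := 0) 0 ((LamDelta.Src.embedFun t).sem ())
      ((LamDelta.Src.tangentPart t).sem ())
      (LamDelta.fderiv_onE_zero (LamDelta.Src.hasDerivAt_tangentPart t))
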